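/- Let $\mathbb{T}=\mathbb{R}\cup\{-\infty\}$ be the tropical semifield (addition is $\max$, multiplication is $+$); for a real number $a$ write $t^a$ for the corresponding element of $\mathbb{T}$. Let $S\subseteq\mathbb{T}$ be a sub-semifield other than the Boolean semifield $\{-\infty,0\}$, and let $\Gamma=\{\gamma\in\mathbb{R}: t^\gamma\in S\}$. Let $n\ge 0$ and let $C$ and $C'$ be real matrices of sizes $k\times(n+1)$ and $k'\times(n+1)$ whose first columns are lexicographically at least the zero vector. Such a matrix $C$ defines a prime congruence on $S[x_1^{\pm1},\dots,x_n^{\pm1}]$: for a term put $\Phi_C(t^a x^u)=C\binom{a}{u}\in\mathbb{R}^k$, let $\Phi_C(f)$ be the lexicographic maximum of the values of $\Phi_C$ on the terms of $f$, put $\Phi_C(0)=-\infty$, and declare $f\sim g$ when $\Phi_C(f)=\Phi_C(g)$. (A congruence $P$ on a semiring $R$ is prime if it is proper and $R/P$ is totally ordered and cancellative.) By finitely many steps, each of which multiplies a row by a positive constant, adds a multiple of a row to a row below it, or removes a row of zeros, $C$ and $C'$ can be transformed into matrices whose first columns have all entries nonnegative and whose rows are linearly independent. Let $\widetilde C$ and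 $\widetilde C'$ be any matrices with these two properties that are obtained in this way from $C$ and $C'$, respectively. Then $C$ and $C'$ define the same prime congruence on $S[x_1^{\pm1},\dots,x_n^{\pm1}]$ if and only if the simplicial flags of cones $\mathcal{C}_\bullet(\widetilde C)$ and $\mathcal{C}_\bullet(\widetilde C')$ are $\Gamma$-locally equivalent. Here, if $\widetilde C$ has rows $w_0,\dots,w_l\in\mathbb{R}_{\ge0}\times\mathbb{R}^n$, then $\mathcal{C}_\bullet(\widetilde C)$ is the flag $\mathcal{C}_0\le\dots\le\mathcal{C}_l$ in which $\mathcal{C}_i$ is the cone generated by $w_0,\dots,w_i$ (the empty flag if $\widetilde C$ has no rows). A $\Gamma$-admissible cone is a strongly convex cone of the form $\{(r,x)\in\mathbb{R}_{\ge0}\times\mathbb{R}^n: r\gamma_j+\langle x,u_j\rangle\le 0\text{ for }j=1,\dots,q\}$ with $q\ge 0$, $\gamma_j\in\Gamma$ and $u_j\in\mathbb{Z}^n$; it is a $\Gamma$-admissible neighborhood of a flag of cones if it meets the relative interior of every cone of the flag. Two flags of cones are $\Gamma$-locally equivalent if they have the same $\Gamma$-admissible neighborhoods. -/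

import Mathlib

set_option linter.unusedSectionVars false

/-! ## The max-plus semifields `G ∪ {-∞}` -/

/-- For a totally ordered abelian group `G`, the semifield `G ∪ {-∞}` whose addition is `max` and
whose multiplication is the addition of `G`. (`Tropical` is the min-plus construction, so the order
of `G` is reversed; the adjoined top element of `Gᵒᵈ` is then `-∞`, the zero of the semiring.) -/
abbrev MaxPlus (G : Type*) : Type _ := Tropical (WithTop Gᵒᵈ)

namespace MaxPlus

/-- The element `t ^ a` of `G ∪ {-∞}` that corresponds to `a : G`. -/
def t {G : Type*} (a : G) : MaxPlus G :=
  Tropical.trop ((OrderDual.toDual a : Gᵒᵈ) : WithTop Gᵒᵈ)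

section

variable {G H : Type*} [AddCommGroup G] [LinearOrder G] [IsOrderedAddMonoid G]
  [AddCommGroup H] [LinearOrder H] [IsOrderedAddMonoid H]

theorem eq_zero_or_t (x : MaxPlus G) : x = 0 ∨ ∃ a : G, x = t a := by
  rcases h : Tropical.untrop x with _ | a
  · exact Or.inl (Tropical.untrop_injective h)
  · exact Or.inr ⟨OrderDual.ofDual a, Tropical.untrop_injective h⟩

theorem t_add (a b : G) : t (a + b) = t a * t b := rfl

theorem t_zero : t (0 : G) = 1 := rfl

theorem t_max (a b : G) : t (max a b) = t a + t b := by
  rcases le_total a b with h | h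
  · rw [max_eq_right h]
    symm
    apply Tropical.add_eq_right
    exact WithTop.coe_le_coe.2 (OrderDual.toDual_le_toDual.2 h)
  · rw [max_eq_left h]
    symm
    apply Tropical.add_eq_left
    exact WithTop.coe_le_coe.2 (OrderDual.toDual_le_toDual.2 h)

theorem t_injective : Function.Injective (t : G → MaxPlus G) := fun _ _ h =>
  OrderDual.toDual.injective (WithTop.coe_injective (Tropical.trop_injective h))

theorem t_ne_zero (a : G) : t a ≠ 0 := Tropical.trop_coe_ne_zero _

/-- The semiring homomorphism `t ^ a ↦ t ^ (φ a)`, `-∞ ↦ -∞`, induced by an order preserving group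
homomorphism `φ`. -/
def map (φ : G →+ H) (hφ : Monotone φ) : MaxPlus G →+* MaxPlus H where
  toFun x := Tropical.trop
    (WithTop.map (fun a => OrderDual.toDual (φ (OrderDual.ofDual a))) (Tropical.untrop x))
  map_one' := by
    change t (φ 0) = 1
    rw [map_zero, t_zero]
  map_zero' := rfl
  map_mul' x y := by
    rcases eq_zero_or_t x with rfl | ⟨a, rfl⟩
    · rw [zero_mul]
      change 0 = 0 * _
      rw [zero_mul]
    rcases eq_zero_or_t y with rfl | ⟨b, rfl⟩
    · rw [mul_zero]
      change 0 = _ * 0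
      rw [mul_zero]
    change t (φ (a + b)) = t (φ a) * t (φ b)
    rw [map_add, t_add]
  map_add' x y := by
    rcases eq_zero_or_t x with rfl | ⟨a, rfl⟩
    · rw [zero_add]
      change _ = 0 + _
      rw [zero_add]
    rcases eq_zero_or_t y with rfl | ⟨b, rfl⟩
    · rw [add_zero]
      change _ = _ + 0
      rw [add_zero]
    rw [← t_max]
    change t (φ (max a b)) = t (φ a) + t (φ b)
    rw [hφ.map_max, t_max]

theorem map_t (φ : G →+ H) (hφ : Monotone φ) (a : G) : map φ hφ (t a) = t (φ a) := rfl

theorem add_eq_or (x y : MaxPlus G) : x + y = x ∨ x + y = y := by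
  rcases le_total x y with h | h
  · exact Or.inl (Tropical.add_eq_left h)
  · exact Or.inr (Tropical.add_eq_right h)

theorem mul_cancel {x y z : MaxPlus G} (hx : x ≠ 0) (h : x * y = x * z) : y = z := by
  obtain ⟨a, rfl⟩ := (eq_zero_or_t x).resolve_left hx
  have key : t (-a) * t a = 1 := by rw [← t_add, neg_add_cancel, t_zero]
  calc y = t (-a) * (t a * y) := by rw [← mul_assoc, key, one_mul]
    _ = t (-a) * (t a * z) := by rw [h]
    _ = z := by rw [← mul_assoc, key, one_mul]

end

end MaxPlus

/-- The tropical semifield `𝕋 = ℝ ∪ {-∞}`. -/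
abbrev TropicalReals : Type := MaxPlus ℝ

/-- `S` is a sub-semifield of `𝕋` that is not the Boolean semifield `{-∞, 0}`. -/
structure IsTropicalSubsemifield (S : Subsemiring TropicalReals) : Prop where
  exists_inv : ∀ a ∈ S, a ≠ 0 → ∃ b ∈ S, a * b = 1
  ne_boolean : ∃ a ∈ S, a ≠ 0 ∧ a ≠ 1

/-- The group `Γ = log (S \ {0})` of a sub-semifield `S` of `𝕋`. -/
def logGroup (S : Subsemiring TropicalReals) : Set ℝ := {γ | MaxPlus.t γ ∈ S}

/-! ## Prime congruences -/

/-- A congruence `P` on an idempotent semiring `R` is prime if it is proper and `R / P` is totally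
ordered (by `x ≥ y ↔ x + y = x`) and cancellative. -/
structure IsPrimeCongruence {R : Type*} [CommSemiring R] (P : RingCon R) : Prop where
  ne_top : P ≠ ⊤
  total : ∀ x y : P.Quotient, x + y = x ∨ x + y = y
  cancel : ∀ x y z : P.Quotient, x ≠ 0 → x * y = x * z → y = z

theorem isPrimeCongruence_ker {R G : Type*} [CommSemiring R] [AddCommGroup G] [LinearOrder G]
    [IsOrderedAddMonoid G] (f : R →+* MaxPlus G) : IsPrimeCongruence (RingCon.ker f) where
  ne_top h := by
    have h1 : RingCon.ker f 0 1 := by rw [h]; trivial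
    rw [RingCon.ker_apply, map_zero, map_one] at h1
    exact MaxPlus.t_ne_zero (0 : G) h1.symm
  total x y := by
    induction x using Quotient.inductionOn'
    induction y using Quotient.inductionOn'
    rename_i a b
    rcases MaxPlus.add_eq_or (f a) (f b) with h | h
    · exact Or.inl ((RingCon.eq _).2 (((RingCon.ker_apply f)).2 (by rw [map_add, h])))
    · exact Or.inr ((RingCon.eq _).2 (((RingCon.ker_apply f)).2 (by rw [map_add, h])))
  cancel x y z := by
    induction x using Quotient.inductionOn'
    induction y using Quotient.inductionOn'
    induction z using Quotient.inductionOn'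
    rename_i a b c
    intro ha h
    have ha' : f a ≠ 0 := fun h0 =>
      ha ((RingCon.eq _).2 ((RingCon.ker_apply f).2 (by rw [h0, map_zero])))
    have h' : f (a * b) = f (a * c) := (RingCon.ker_apply f).1 ((RingCon.eq _).1 h)
    rw [map_mul, map_mul] at h'
    exact (RingCon.eq _).2 ((RingCon.ker_apply f).2 (MaxPlus.mul_cancel ha' h'))

/-! ## The prime congruence defined by a matrix -/

/-- The Laurent polynomial semiring `S[x₁^{±1}, …, xₙ^{±1}] = S[ℤⁿ]`. -/
abbrev LaurentSemiring (S : Subsemiring TropicalReals) (n : ℕ) : Type :=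
  AddMonoidAlgebra S (Fin n → ℤ)

/-- The exponent vector `(a, u)` of the term `t ^ a χ ^ u`. -/
def exponentVector {n : ℕ} (a : ℝ) (u : Fin n → ℤ) : Fin (n + 1) → ℝ :=
  Fin.cons a fun i => (u i : ℝ)

theorem exponentVector_add {n : ℕ} (a b : ℝ) (u v : Fin n → ℤ) :
    exponentVector (a + b) (u + v) = exponentVector a u + exponentVector b v := by
  funext i
  refine Fin.cases ?_ (fun i => ?_) i <;> simp [exponentVector]

theorem exponentVector_zero {n : ℕ} : exponentVector 0 (0 : Fin n → ℤ) = 0 := by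
  funext i
  refine Fin.cases ?_ (fun i => ?_) i <;> simp [exponentVector]

section

variable {n k : ℕ}

/-- The first column of `C` is lexicographically at least the zero vector. -/
def FirstColumnLexNonneg (C : Matrix (Fin k) (Fin (n + 1)) ℝ) : Prop :=
  (0 : Lex (Fin k → ℝ)) ≤ toLex (fun i => C i 0)

/-- `a ↦ C (a, 0)`, with values in `ℝᵏ` ordered lexicographically. -/
def coefficientHom (C : Matrix (Fin k) (Fin (n + 1)) ℝ) : ℝ →+ Lex (Fin k → ℝ) where
  toFun a := toLex (C.mulVec (exponentVector a 0))
  map_zero' := by rw [exponentVector_zero, Matrix.mulVec_zero]; rfl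
  map_add' a b := by
    rw [← toLex_add, ← Matrix.mulVec_add, ← exponentVector_add, add_zero]

theorem coefficientHom_apply (C : Matrix (Fin k) (Fin (n + 1)) ℝ) (a : ℝ) (i : Fin k) :
    ofLex (coefficientHom C a) i = C i 0 * a := by
  simp [coefficientHom, exponentVector, Matrix.mulVec, dotProduct, Fin.sum_univ_succ]

theorem coefficientHom_monotone (C : Matrix (Fin k) (Fin (n + 1)) ℝ)
    (hC : FirstColumnLexNonneg C) : Monotone (coefficientHom C) := by
  intro a b hab
  rcases hab.eq_or_lt with rfl | hab
  · exact le_rfl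
  rcases (show (0 : Lex (Fin k → ℝ)) ≤ toLex (fun i => C i 0) from hC).eq_or_lt with h | h
  · have h' : ∀ i, C i 0 = 0 := fun i => (congrFun (congrArg ofLex h) i).symm
    refine le_of_eq (ofLex.injective (funext fun i => ?_))
    rw [coefficientHom_apply, coefficientHom_apply, h', zero_mul, zero_mul]
  · obtain ⟨i, hi, hlt⟩ := h
    refine le_of_lt ⟨i, fun j hj => ?_, ?_⟩
    · have h0 : C j 0 = 0 := (hi j hj).symm
      change ofLex (coefficientHom C a) j = ofLex (coefficientHom C b) j
      rw [coefficientHom_apply, coefficientHom_apply, h0, zero_mul, zero_mul]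
    · have h0 : 0 < C i 0 := hlt
      change ofLex (coefficientHom C a) i < ofLex (coefficientHom C b) i
      rw [coefficientHom_apply, coefficientHom_apply]
      exact mul_lt_mul_of_pos_left hab h0

/-- `χ ^ u ↦ t ^ (C (0, u))`. -/
def characterHom (C : Matrix (Fin k) (Fin (n + 1)) ℝ) :
    Multiplicative (Fin n → ℤ) →* MaxPlus (Lex (Fin k → ℝ)) where
  toFun u := MaxPlus.t (toLex (C.mulVec (exponentVector 0 u.toAdd)))
  map_one' := by
    rw [toAdd_one, exponentVector_zero, Matrix.mulVec_zero]; rfl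
  map_mul' u v := by
    rw [← MaxPlus.t_add, ← toLex_add, ← Matrix.mulVec_add, ← exponentVector_add, add_zero,
      toAdd_mul]

/-- The semiring homomorphism `Φ : S[ℤⁿ] → ℝᵏ ∪ {-∞}` defined by `C`: it sends a term `t ^ a χ ^ u`
to `C (a, u)`, hence a sum of terms to the lexicographic maximum of their images. -/
noncomputable def matrixHom (S : Subsemiring TropicalReals) (C : Matrix (Fin k) (Fin (n + 1)) ℝ)
    (hC : FirstColumnLexNonneg C) : LaurentSemiring S n →+* MaxPlus (Lex (Fin k → ℝ)) :=
  AddMonoidAlgebra.liftNCRingHom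
    ((MaxPlus.map (coefficientHom C) (coefficientHom_monotone C hC)).comp S.subtype)
    (characterHom C) (fun _ _ => Commute.all _ _)

theorem matrixHom_term (S : Subsemiring TropicalReals) (C : Matrix (Fin k) (Fin (n + 1)) ℝ)
    (hC : FirstColumnLexNonneg C) (a : ℝ) (ha : MaxPlus.t a ∈ S) (u : Fin n → ℤ) :
    matrixHom S C hC (AddMonoidAlgebra.single u ⟨MaxPlus.t a, ha⟩) =
      MaxPlus.t (toLex (C.mulVec (exponentVector a u))) := by
  have h : exponentVector a u = exponentVector a 0 + exponentVector 0 u := by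
    rw [← exponentVector_add, add_zero, zero_add]
  rw [matrixHom, AddMonoidAlgebra.liftNCRingHom_single, h, Matrix.mulVec_add, toLex_add,
    MaxPlus.t_add]
  rfl

/-- The congruence on `S[x₁^{±1}, …, xₙ^{±1}]` defined by `C`: `f ~ g` when `Φ(f) = Φ(g)`. -/
noncomputable def matrixCongruence (S : Subsemiring TropicalReals) (C : Matrix (Fin k) (Fin (n + 1)) ℝ)
    (hC : FirstColumnLexNonneg C) : RingCon (LaurentSemiring S n) :=
  RingCon.ker (matrixHom S C hC)

theorem matrixCongruence_isPrime (S : Subsemiring TropicalReals)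
    (C : Matrix (Fin k) (Fin (n + 1)) ℝ) (hC : FirstColumnLexNonneg C) :
    IsPrimeCongruence (matrixCongruence S C hC) :=
  isPrimeCongruence_ker _

end

/-! ## Downward Gaussian elimination -/

/-- `DownwardReduction C D`: the matrix `D` is obtained from `C` by finitely many steps, each of
which multiplies a row by a positive constant, adds a multiple of a row to a row below it, or
removes a row of zeros. -/
inductive DownwardReduction {m k : ℕ} (C : Matrix (Fin k) (Fin m) ℝ) :
    {l : ℕ} → Matrix (Fin l) (Fin m) ℝ → Prop
  | refl : DownwardReduction C C
  | scale {l : ℕ} {D : Matrix (Fin l) (Fin m) ℝ} (h : DownwardReduction C D)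
      (i : Fin l) (c : ℝ) (hc : 0 < c) : DownwardReduction C (D.updateRow i (c • D i))
  | addRow {l : ℕ} {D : Matrix (Fin l) (Fin m) ℝ} (h : DownwardReduction C D)
      (i j : Fin l) (hij : i < j) (c : ℝ) : DownwardReduction C (D.updateRow j (D j + c • D i))
  | removeRow {l : ℕ} {D : Matrix (Fin (l + 1)) (Fin m) ℝ} (h : DownwardReduction C D)
      (i : Fin (l + 1)) (hi : D i = 0) : DownwardReduction C (D.submatrix i.succAbove id)

/-- All entries of the first column are nonnegative and the rows are linearly independent. -/
structure IsReducedMatrix {n k : ℕ} (D : Matrix (Fin k) (Fin (n + 1)) ℝ) : Prop where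
  nonneg : ∀ i, 0 ≤ D i 0
  linearIndependent : LinearIndependent ℝ fun i => D i

/-! ## Flags of cones in `ℝ≥0 × N_ℝ`

Here `M = ℤⁿ` and `N_ℝ = Hom(M, ℝ) = ℝⁿ`; a point `(r, ξ)` of `ℝ × N_ℝ` is a vector
`w : Fin (n + 1) → ℝ` with `w 0 = r`, and its pairing with `(γ, u) ∈ ℝ × M` is the dot product
`w ⬝ᵥ exponentVector γ u = r γ + ⟨ξ, u⟩`. -/

/-- A flag `𝒞₀ ≤ ⋯ ≤ 𝒞ₖ₋₁` of `k` strongly convex polyhedral cones in `ℝ≥0 × N_ℝ`, each a face of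
the following ones, with `dim 𝒞ᵢ = i + 1`. -/
structure FlagOfCones (n k : ℕ) where
  cone : Fin k → PointedCone ℝ (Fin (n + 1) → ℝ)
  polyhedral : ∀ i, (cone i).FG
  stronglyConvex : ∀ i, (cone i : ConvexCone ℝ (Fin (n + 1) → ℝ)).Salient
  mem_halfSpace : ∀ i, ∀ w ∈ cone i, 0 ≤ w 0
  dim : ∀ i, Module.finrank ℝ (Submodule.span ℝ (cone i : Set (Fin (n + 1) → ℝ))) = i + 1
  face : ∀ i j, i ≤ j → (cone i).IsFaceOf (cone j)

/-- The flag is simplicial if all its cones are. -/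
def FlagOfCones.IsSimplicial {n k : ℕ} (F : FlagOfCones n k) : Prop :=
  ∀ i, (F.cone i).IsSimplicial

/-- A `Γ`-admissible cone: a strongly convex cone of the form
`{(r, x) ∈ ℝ≥0 × N_ℝ : r γ + ⟨x, u⟩ ≤ 0 for all (γ, u) ∈ E}` with `E ⊆ Γ × M` finite. -/
def IsAdmissibleCone {n : ℕ} (Γ : Set ℝ) (D : PointedCone ℝ (Fin (n + 1) → ℝ)) : Prop :=
  (D : ConvexCone ℝ (Fin (n + 1) → ℝ)).Salient ∧
    ∃ E : Finset (ℝ × (Fin n → ℤ)), (∀ p ∈ E, p.1 ∈ Γ) ∧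
      ∀ w, w ∈ D ↔ 0 ≤ w 0 ∧ ∀ p ∈ E, w ⬝ᵥ exponentVector p.1 p.2 ≤ 0

/-- A `Γ`-admissible neighborhood of a flag of cones: a `Γ`-admissible cone that meets the relative
interior of each cone of the flag. -/
def IsAdmissibleNeighborhood {n k : ℕ} (Γ : Set ℝ) (D : PointedCone ℝ (Fin (n + 1) → ℝ))
    (F : FlagOfCones n k) : Prop :=
  IsAdmissibleCone Γ D ∧
    ∀ i, ((D : Set (Fin (n + 1) → ℝ)) ∩
      intrinsicInterior ℝ (F.cone i : Set (Fin (n + 1) → ℝ))).Nonempty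

/-- Two flags of cones are `Γ`-locally equivalent if they have the same `Γ`-admissible
neighborhoods. -/
def LocallyEquivalent {n k k' : ℕ} (Γ : Set ℝ) (F : FlagOfCones n k) (F' : FlagOfCones n k') :
    Prop :=
  ∀ D : PointedCone ℝ (Fin (n + 1) → ℝ),
    IsAdmissibleNeighborhood Γ D F ↔ IsAdmissibleNeighborhood Γ D F'

section

variable {n k : ℕ}

/-- The cone generated by the rows `0, …, i` of `D`. -/
def rowCone (D : Matrix (Fin k) (Fin (n + 1)) ℝ) (i : Fin k) :
    PointedCone ℝ (Fin (n + 1) → ℝ) :=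
  PointedCone.hull ℝ ((fun j => D j) '' Set.Iic i)

/-- Elements of the cone generated by the first rows are nonnegative combinations of them. -/
theorem mem_rowCone (D : Matrix (Fin k) (Fin (n + 1)) ℝ) (i : Fin k) (w : Fin (n + 1) → ℝ) :
    w ∈ rowCone D i ↔
      ∃ c : Fin k → ℝ, (∀ j, 0 ≤ c j) ∧ (∀ j, i < j → c j = 0) ∧ ∑ j, c j • D j = w := by
  constructor
  · intro hw
    refine Submodule.span_induction (p := fun w _ => ∃ c : Fin k → ℝ, (∀ j, 0 ≤ c j) ∧
      (∀ j, i < j → c j = 0) ∧ ∑ j, c j • D j = w) ?_ ?_ ?_ ?_ hw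
    · rintro _ ⟨j, hj, rfl⟩
      refine ⟨Pi.single j 1, fun l => ?_, fun l hl => ?_, ?_⟩
      · by_cases h : l = j
        · subst h; simp
        · simp [h]
      · have hne : l ≠ j := fun h => absurd hl (not_lt.2 (h ▸ hj))
        simp [hne]
      · rw [Finset.sum_eq_single j]
        · simp
        · intro l _ hl; simp [hl]
        · simp
    · exact ⟨0, fun _ => le_rfl, fun _ _ => rfl, by simp⟩
    · rintro x y _ _ ⟨c, hc, hc', rfl⟩ ⟨d, hd, hd', rfl⟩
      exact ⟨c + d, fun j => add_nonneg (hc j) (hd j),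
        fun j hj => by simp [hc' j hj, hd' j hj], by simp [add_smul, Finset.sum_add_distrib]⟩
    · rintro a x _ ⟨c, hc, hc', rfl⟩
      refine ⟨fun j => (a : ℝ) * c j, fun j => mul_nonneg a.2 (hc j),
        fun j hj => by simp [hc' j hj], ?_⟩
      rw [Finset.smul_sum]
      exact Finset.sum_congr rfl fun j _ => mul_smul (a : ℝ) (c j) (D j)
  · rintro ⟨c, hc, hc', rfl⟩
    refine Submodule.sum_mem _ fun j _ => ?_
    by_cases h : i < j
    · rw [hc' j h, zero_smul]; exact Submodule.zero_mem _
    · exact PointedCone.smul_mem _ (hc j)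
        (PointedCone.subset_hull ⟨j, not_lt.1 h, rfl⟩)

/-- The flag of cones of a reduced matrix: its `i`-th cone is generated by the rows `0, …, i`. -/
def matrixFlag (D : Matrix (Fin k) (Fin (n + 1)) ℝ) (hD : IsReducedMatrix D) :
    FlagOfCones n k where
  cone := rowCone D
  polyhedral i := Submodule.fg_span ((Set.toFinite _).image _)
  stronglyConvex i := by
    intro w hw hw0 hnw
    obtain ⟨c, hc, -, rfl⟩ := (mem_rowCone D i w).1 hw
    obtain ⟨d, hd, -, hd'⟩ := (mem_rowCone D i _).1 hnw
    have hs : ∑ j, (c j + d j) • D j = 0 := by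
      simp only [add_smul, Finset.sum_add_distrib, hd', add_neg_cancel]
    have hz := Fintype.linearIndependent_iff.1 hD.linearIndependent _ hs
    have hc0 : ∀ j, c j = 0 := fun j => by
      have h1 := hz j
      have h2 := hc j
      have h3 := hd j
      linarith
    exact hw0 (by simp [hc0])
  mem_halfSpace i w hw := by
    obtain ⟨c, hc, -, rfl⟩ := (mem_rowCone D i w).1 hw
    rw [Finset.sum_apply]
    exact Finset.sum_nonneg fun j _ => mul_nonneg (hc j) (hD.nonneg j)
  dim i := by
    have h1 : Submodule.span ℝ (rowCone D i : Set (Fin (n + 1) → ℝ)) =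
        Submodule.span ℝ (Set.range fun j : Set.Iic i => D j) := by
      have h2 : (Set.range fun j : Set.Iic i => D j) = (fun j => D j) '' Set.Iic i := by
        rw [Set.image_eq_range]
      rw [h2]
      exact Submodule.span_span_of_tower _ ℝ _
    have h3 : LinearIndependent ℝ (fun j : Set.Iic i => D j) :=
      hD.linearIndependent.comp (fun j : Set.Iic i => (j : Fin k)) Subtype.val_injective
    rw [h1]
    refine (finrank_span_eq_card h3).trans ?_
    simp
  face i j hij := by
    refine ⟨Submodule.span_mono (Set.image_mono (Set.Iic_subset_Iic.2 hij)), ?_⟩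
    intro x y a hx hy ha hxy
    obtain ⟨c, hc, -, rfl⟩ := (mem_rowCone D j x).1 hx
    obtain ⟨d, hd, -, rfl⟩ := (mem_rowCone D j y).1 hy
    obtain ⟨e, -, he', hsum⟩ := (mem_rowCone D i _).1 hxy
    have hs : ∑ l, (a * c l + d l - e l) • D l = 0 := by
      simp only [sub_smul, add_smul, mul_smul, Finset.sum_sub_distrib, Finset.sum_add_distrib,
        ← Finset.smul_sum, hsum, sub_self]
    have hz := Fintype.linearIndependent_iff.1 hD.linearIndependent _ hs
    refine (mem_rowCone D i _).2 ⟨c, hc, fun l hl => ?_, rfl⟩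
    have h1 := hz l
    rw [he' l hl] at h1
    have h2 := hd l
    have h3 := mul_nonneg ha.le (hc l)
    have h4 : a * c l = 0 := by linarith
    exact (mul_eq_zero.1 h4).resolve_left ha.ne'

theorem matrixFlag_isSimplicial (D : Matrix (Fin k) (Fin (n + 1)) ℝ) (hD : IsReducedMatrix D) :
    (matrixFlag D hD).IsSimplicial := fun _ =>
  PointedCone.IsSimplicial.hull ((Set.toFinite _).image _)
    (hD.linearIndependent.linearIndepOn_id.mono (Set.image_subset_range _ _))

end

/-! Both sides of the equivalence depend only on which exponent vectors `(γ, u) ∈ Γ × ℤⁿ` have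
lexicographically positive image under the matrix.

For the congruence, comparing `Φ(f)` with `Φ(g)` amounts to comparing terms pairwise. The exponent
differences stay in `Γ × ℤⁿ` because `Γ` is a group. Conversely, `1 + t ^ γ χ ^ u ~ 1` holds exactly
when `(γ, u)` is not lexicographically positive (`matrixCongruence_eq_iff`). Downward row operations
preserve lexicographic sign, so the reduced matrix has the same positive vectors
(`DownwardReduction.lexPositive_mulVec_iff`).

For the flag, the link is `forall_inter_intrinsicInterior_nonempty_iff`. If the first nonzero
pairing of `p` with a row is positive and occurs at row `i`, then `p` is positive on the relative
interior of the `i`-th cone, so no cone on which `p ≤ 0` meets it. If no vector of a finite set `E`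
is positive, then `∑ εʲ wⱼ` over `j ≤ i`, with `ε > 0` small, lies in that relative interior and
satisfies all inequalities of `E`. Hence the positive vectors determine the admissible
neighborhoods. Conversely, any nonpositive vector is one of the inequalities of some strongly convex
neighborhood, so the neighborhoods determine the positive vectors. -/

/-! ## Lexicographic positivity -/

/-- The first nonzero entry of `a` exists and is positive. -/
def LexPositive {k : ℕ} (a : Fin k → ℝ) : Prop :=
  ∃ i, (∀ j < i, a j = 0) ∧ 0 < a i

theorem toLex_lt_toLex_iff_lexPositive {k : ℕ} (a b : Fin k → ℝ) :
    toLex a < toLex b ↔ LexPositive (b - a) := by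
  constructor
  · rintro ⟨i, hi, hlt⟩
    refine ⟨i, fun j hj => ?_, sub_pos.2 hlt⟩
    have h : a j = b j := hi j hj
    simp [h]
  · rintro ⟨i, hi, hlt⟩
    exact ⟨i, fun j hj => (sub_eq_zero.1 (hi j hj)).symm, sub_pos.1 hlt⟩

theorem LexPositive.not_neg {k : ℕ} {a : Fin k → ℝ} (ha : LexPositive a) :
    ¬ LexPositive (-a) := by
  intro h
  have h1 : toLex 0 < toLex a := (toLex_lt_toLex_iff_lexPositive _ _).2 (by simpa using ha)
  have h2 : toLex a < toLex 0 := (toLex_lt_toLex_iff_lexPositive _ _).2 (by simpa using h)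
  exact lt_asymm h1 h2

theorem lexPositive_update_mul {k : ℕ} (a : Fin k → ℝ) (i : Fin k) {c : ℝ} (hc : 0 < c) :
    LexPositive (Function.update a i (c * a i)) ↔ LexPositive a := by
  have h0 : ∀ j, Function.update a i (c * a i) j = 0 ↔ a j = 0 := fun j => by
    rcases eq_or_ne j i with rfl | h
    · simp [hc.ne']
    · simp [h]
  have h1 : ∀ j, 0 < Function.update a i (c * a i) j ↔ 0 < a j := fun j => by
    rcases eq_or_ne j i with rfl | h
    · simp [hc]
    · simp [h]
  simp only [LexPositive, h0, h1]

/-- Entry `j` changes only if `a i ≠ 0`; the leading entry then has index at most `i < j` and is not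
affected. -/
theorem LexPositive.update_add {k : ℕ} {a : Fin k → ℝ} (ha : LexPositive a) {i j : Fin k}
    (hij : i < j) (c : ℝ) : LexPositive (Function.update a j (a j + c * a i)) := by
  obtain ⟨m, hm, hpos⟩ := ha
  refine ⟨m, fun l hl => ?_, ?_⟩
  · rcases eq_or_ne l j with rfl | h
    · simp [hm l hl, hm i (hij.trans hl)]
    · simp [h, hm l hl]
  · rcases eq_or_ne m j with rfl | h
    · simpa [hm i hij] using hpos
    · simpa [h] using hpos

theorem lexPositive_update_add {k : ℕ} (a : Fin k → ℝ) {i j : Fin k} (hij : i < j) (c : ℝ) :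
    LexPositive (Function.update a j (a j + c * a i)) ↔ LexPositive a := by
  refine ⟨fun h => ?_, fun h => h.update_add hij c⟩
  have h2 := h.update_add hij (-c)
  simpa [hij.ne] using h2

theorem lexPositive_comp_succAbove {k : ℕ} (a : Fin (k + 1) → ℝ) (i : Fin (k + 1))
    (hi : a i = 0) : LexPositive (fun j => a (i.succAbove j)) ↔ LexPositive a := by
  constructor
  · rintro ⟨m, hm, hpos⟩
    refine ⟨i.succAbove m, fun l hl => ?_, hpos⟩
    rcases Fin.eq_self_or_eq_succAbove i l with rfl | ⟨l, rfl⟩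
    · exact hi
    · exact hm l (Fin.succAbove_lt_succAbove_iff.1 hl)
  · rintro ⟨m, hm, hpos⟩
    rcases Fin.eq_self_or_eq_succAbove i m with rfl | ⟨m, rfl⟩
    · exact absurd hi hpos.ne'
    · exact ⟨m, fun l hl => hm _ (Fin.succAbove_lt_succAbove_iff.2 hl), hpos⟩

open Filter Topology in
/-- If `a` is lexicographically at most zero, then `∑ εʲ aⱼ ≤ 0` for all small `ε > 0`. -/
theorem eventually_sum_pow_mul_nonpos {k : ℕ} {a : Fin k → ℝ} (ha : ¬ LexPositive a) :
    ∀ᶠ ε in 𝓝[>] (0 : ℝ), ∑ j : Fin k, ε ^ (j : ℕ) * a j ≤ 0 := by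
  induction k with
  | zero => simp
  | succ k ih =>
    -- A negative `a 0` is the limit of the sum as `ε → 0`. If `a 0 = 0`, a factor `ε` comes out and
    -- the induction hypothesis applies to the tail.
    rcases lt_trichotomy (a 0) 0 with h | h | h
    · have hc : Continuous fun ε : ℝ => ∑ j : Fin (k + 1), ε ^ (j : ℕ) * a j := by fun_prop
      have h0 : ∑ j : Fin (k + 1), (0 : ℝ) ^ (j : ℕ) * a j = a 0 := by simp [Fin.sum_univ_succ]
      have ht := (hc.tendsto 0).eventually_lt_const (u := 0) (by rw [h0]; exact h)
      exact (ht.filter_mono nhdsWithin_le_nhds).mono fun _ => le_of_lt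
    · have htail : ¬ LexPositive fun j : Fin k => a j.succ := by
        have h1 := lexPositive_comp_succAbove a 0 h
        simp only [Fin.zero_succAbove] at h1
        rwa [h1]
      filter_upwards [ih htail, self_mem_nhdsWithin] with ε hε hpos
      have hpos : 0 < ε := hpos
      rw [Fin.sum_univ_succ, h, mul_zero, zero_add]
      have h2 : ∑ j : Fin k, ε ^ (j.succ : ℕ) * a j.succ =
          ε * ∑ j : Fin k, ε ^ (j : ℕ) * a j.succ := by
        rw [Finset.mul_sum]
        exact Finset.sum_congr rfl fun j _ => by rw [Fin.val_succ, pow_succ]; ring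
      rw [h2]
      exact mul_nonpos_of_nonneg_of_nonpos hpos.le hε
    · exact absurd ⟨0, fun j hj => absurd hj (Fin.not_lt_zero j), h⟩ ha

/-! ## Downward reductions -/

namespace DownwardReduction

variable {m k l k' : ℕ} {C : Matrix (Fin k) (Fin m) ℝ} {D : Matrix (Fin l) (Fin m) ℝ}
  {E : Matrix (Fin k') (Fin m) ℝ}

theorem trans (h : DownwardReduction C D) (h' : DownwardReduction D E) :
    DownwardReduction C E := by
  induction h' with
  | refl => exact h
  | scale _ i c hc ih => exact ih.scale i c hc
  | addRow _ i j hij c ih => exact ih.addRow i j hij c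
  | removeRow _ i hi ih => exact ih.removeRow i hi

/-- Each step acts on the vector of pairings with `p` as it acts on the rows, and each such
operation preserves lexicographic positivity. -/
theorem lexPositive_mulVec_iff (h : DownwardReduction C D) (p : Fin m → ℝ) :
    LexPositive (D.mulVec p) ↔ LexPositive (C.mulVec p) := by
  induction h with
  | refl => rfl
  | @scale l D _ i c hc ih =>
    rw [← ih, ← lexPositive_update_mul (D.mulVec p) i hc]
    refine iff_of_eq (congrArg LexPositive (funext fun j => ?_))
    rcases eq_or_ne j i with rfl | h
    · rw [Function.update_self]
      change D.updateRow j (c • D j) j ⬝ᵥ p = c * (D j ⬝ᵥ p)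
      rw [Matrix.updateRow_self, smul_dotProduct, smul_eq_mul]
    · simp [Matrix.mulVec, h]
  | @addRow l D _ i j hij c ih =>
    rw [← ih, ← lexPositive_update_add (D.mulVec p) hij c]
    refine iff_of_eq (congrArg LexPositive (funext fun j' => ?_))
    rcases eq_or_ne j' j with rfl | h
    · rw [Function.update_self]
      change D.updateRow j' (D j' + c • D i) j' ⬝ᵥ p = D j' ⬝ᵥ p + c * (D i ⬝ᵥ p)
      rw [Matrix.updateRow_self, add_dotProduct, smul_dotProduct, smul_eq_mul]
    · simp [Matrix.mulVec, h]
  | @removeRow l D _ i hi ih =>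
    rw [← ih]
    exact lexPositive_comp_succAbove (D.mulVec p) i (by simp [Matrix.mulVec, hi])

/-- Multiples of one row can be added simultaneously to several rows below it. -/
theorem exists_add_multiples (C : Matrix (Fin k) (Fin m) ℝ) (i : Fin k) (c : Fin k → ℝ)
    (s : Finset (Fin k)) (hs : ∀ j ∈ s, i < j) :
    ∃ D : Matrix (Fin k) (Fin m) ℝ, DownwardReduction C D ∧
      (∀ j ∈ s, D j = C j + c j • C i) ∧ ∀ j ∉ s, D j = C j := by
  induction s using Finset.induction_on with
  | empty => exact ⟨C, .refl, by simp, by simp⟩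
  | insert j s hj ih =>
    obtain ⟨D, hD, hin, hout⟩ := ih fun j hj => hs j (Finset.mem_insert_of_mem hj)
    have hij : i < j := hs j (Finset.mem_insert_self _ _)
    have hi : D i = C i :=
      hout i fun hi => (hs i (Finset.mem_insert_of_mem hi)).false
    refine ⟨_, hD.addRow i j hij (c j), fun l hl => ?_, fun l hl => ?_⟩
    · rcases eq_or_ne l j with rfl | h
      · rw [Matrix.updateRow_self, hi, hout l hj]
      · rw [Matrix.updateRow_ne h, hin l ((Finset.mem_insert.1 hl).resolve_left h)]
    · rw [Finset.mem_insert, not_or] at hl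
      rw [Matrix.updateRow_ne hl.1, hout l hl.2]

/-- A linear combination of rows can be added to a row below them. -/
theorem updateRow_add_sum (C : Matrix (Fin k) (Fin m) ℝ) (j : Fin k) (c : Fin k → ℝ)
    (s : Finset (Fin k)) (hs : ∀ i ∈ s, i < j) :
    DownwardReduction C (C.updateRow j (C j + ∑ i ∈ s, c i • C i)) := by
  induction s using Finset.induction_on with
  | empty => simpa using DownwardReduction.refl
  | insert i s hi ih =>
    have hij : i < j := hs i (Finset.mem_insert_self _ _)
    have h := (ih fun i hi => hs i (Finset.mem_insert_of_mem hi)).addRow i j hij (c i)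
    rw [Matrix.updateRow_self, Matrix.updateRow_ne hij.ne, Matrix.updateRow_idem] at h
    rwa [Finset.sum_insert hi, add_comm (c i • C i), ← add_assoc]

end DownwardReduction

/-! ### Existence of a reduced matrix -/

section

variable {n k : ℕ}

/-- The first nonzero entry of the first column, if any, is positive and serves as a pivot to clear
the entries below it. -/
theorem exists_downwardReduction_nonneg (C : Matrix (Fin k) (Fin (n + 1)) ℝ)
    (hC : FirstColumnLexNonneg C) :
    ∃ D : Matrix (Fin k) (Fin (n + 1)) ℝ, DownwardReduction C D ∧ ∀ i, 0 ≤ D i 0 := by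
  rcases (show (0 : Lex (Fin k → ℝ)) ≤ toLex (fun i => C i 0) from hC).eq_or_lt with h | h
  · exact ⟨C, .refl, fun i => (congrFun (congrArg ofLex h) i).le⟩
  · obtain ⟨i, hi, hlt⟩ := h
    have hi : ∀ j < i, C j 0 = 0 := fun j hj => (hi j hj).symm
    have hlt : 0 < C i 0 := hlt
    obtain ⟨D, hD, hin, hout⟩ := DownwardReduction.exists_add_multiples C i
      (fun j => -(C j 0 / C i 0)) (Finset.Ioi i) (fun j hj => Finset.mem_Ioi.1 hj)
    refine ⟨D, hD, fun j => ?_⟩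
    rcases lt_trichotomy j i with h | rfl | h
    · rw [hout j (by simpa using h.le), hi j h]
    · rw [hout j (by simp)]; exact hlt.le
    · rw [hin j (by simpa using h)]
      simp [hlt.ne']

/-- In a linear relation, the last row with nonzero coefficient is a combination of the rows above
it, so it can be turned into zero and removed. The other rows do not change, so the first column
stays nonnegative. -/
theorem exists_downwardReduction_isReducedMatrix_of_nonneg (C : Matrix (Fin k) (Fin (n + 1)) ℝ)
    (hC : ∀ i, 0 ≤ C i 0) :
    ∃ (l : ℕ) (D : Matrix (Fin l) (Fin (n + 1)) ℝ),
      DownwardReduction C D ∧ IsReducedMatrix D := by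
  induction k with
  | zero => exact ⟨0, C, .refl, hC, linearIndependent_empty_type⟩
  | succ k ih =>
    by_cases hli : LinearIndependent ℝ fun i => C i
    · exact ⟨k + 1, C, .refl, hC, hli⟩
    rw [Fintype.linearIndependent_iff] at hli
    push Not at hli
    obtain ⟨g, hg, i, hi⟩ := hli
    obtain ⟨j, hj, hmax⟩ := Finset.exists_maximal (s := Finset.univ.filter fun j => g j ≠ 0)
      ⟨i, by simpa using hi⟩
    have hj : g j ≠ 0 := by simpa using hj
    have hgt : ∀ l, j < l → g l = 0 := fun l hl => by
      by_contra h
      exact (hmax (by simpa using h) hl.le).not_gt hl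
    have hrow : C j + ∑ l ∈ Finset.Iio j, (g l / g j) • C l = 0 := by
      have h1 : ∑ l ∈ Finset.Iic j, (g l / g j) • C l = 0 := by
        have h2 : (g j)⁻¹ • ∑ l, g l • C l = 0 := by rw [hg, smul_zero]
        rw [Finset.smul_sum] at h2
        rw [← h2]
        refine (Finset.sum_subset (Finset.subset_univ _) fun l _ hl => ?_).trans
          (Finset.sum_congr rfl fun l _ => by rw [smul_smul, div_eq_inv_mul])
        rw [hgt l (by simpa using hl), zero_div, zero_smul]
      rw [← Finset.Iio_insert, Finset.sum_insert (by simp), div_self hj, one_smul] at h1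
      exact h1
    have h := DownwardReduction.updateRow_add_sum C j (fun l => g l / g j) (Finset.Iio j)
      (fun l hl => Finset.mem_Iio.1 hl)
    rw [hrow] at h
    have h' := h.removeRow j (by rw [Matrix.updateRow_self])
    obtain ⟨l, D, hD, hred⟩ :=
      ih ((C.updateRow j 0).submatrix j.succAbove id) fun i => by
      rw [Matrix.submatrix_apply, Matrix.updateRow_ne (Fin.succAbove_ne j i)]
      exact hC _
    exact ⟨l, D, h'.trans hD, hred⟩

theorem exists_downwardReduction_isReducedMatrix (C : Matrix (Fin k) (Fin (n + 1)) ℝ)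
    (hC : FirstColumnLexNonneg C) :
    ∃ (l : ℕ) (D : Matrix (Fin l) (Fin (n + 1)) ℝ),
      DownwardReduction C D ∧ IsReducedMatrix D := by
  obtain ⟨C₁, h₁, hnonneg⟩ := exists_downwardReduction_nonneg C hC
  obtain ⟨l, D, hD, hred⟩ := exists_downwardReduction_isReducedMatrix_of_nonneg C₁ hnonneg
  exact ⟨l, D, h₁.trans hD, hred⟩

end

/-! ## The congruence defined by a matrix, in terms of the order on terms -/

namespace MaxPlus

variable {G : Type*} [AddCommGroup G] [LinearOrder G] [IsOrderedAddMonoid G]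

/-- The order of `Tropical` is the min-plus one: larger exponents are smaller elements, sums are
minima, and `0` is the greatest element. -/
theorem t_le_t_iff {a b : G} : (t a : MaxPlus G) ≤ t b ↔ b ≤ a := by
  rw [← Tropical.untrop_le_iff]
  exact WithTop.coe_le_coe.trans OrderDual.toDual_le_toDual

theorem zero_le_iff {x : MaxPlus G} : 0 ≤ x ↔ x = 0 := by
  rw [← Tropical.add_eq_right_iff, add_zero]

theorem le_sum_iff {ι : Type*} (s : Finset ι) (f : ι → MaxPlus G) (x : MaxPlus G) :
    x ≤ ∑ i ∈ s, f i ↔ ∀ i ∈ s, x ≤ f i := by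
  classical
  induction s using Finset.induction_on with
  | empty => simp
  | insert i s hi ih =>
    rw [Finset.sum_insert hi, Finset.forall_mem_insert, ← ih, ← Tropical.untrop_le_iff,
      Tropical.untrop_add, le_min_iff, Tropical.untrop_le_iff, Tropical.untrop_le_iff]

/-- The condition `x ≠ 0` is needed for the empty sum, which is the greatest element. -/
theorem sum_le_iff {ι : Type*} (s : Finset ι) (f : ι → MaxPlus G) {x : MaxPlus G} (hx : x ≠ 0) :
    ∑ i ∈ s, f i ≤ x ↔ ∃ i ∈ s, f i ≤ x := by
  classical
  induction s using Finset.induction_on with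
  | empty => simpa [zero_le_iff] using hx
  | insert i s hi ih =>
    rw [Finset.sum_insert hi, Finset.exists_mem_insert, ← ih, ← Tropical.untrop_le_iff,
      Tropical.untrop_add, min_le_iff, Tropical.untrop_le_iff, Tropical.untrop_le_iff]

end MaxPlus

section

variable {S : Subsemiring TropicalReals} {n k k' : ℕ}

theorem IsTropicalSubsemifield.neg_mem_logGroup (hS : IsTropicalSubsemifield S) {a : ℝ}
    (ha : a ∈ logGroup S) : -a ∈ logGroup S := by
  obtain ⟨b, hb, hab⟩ := hS.exists_inv _ ha (MaxPlus.t_ne_zero a)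
  have h : b = MaxPlus.t (-a) :=
    MaxPlus.mul_cancel (MaxPlus.t_ne_zero a)
      (by rw [hab, ← MaxPlus.t_add, add_neg_cancel, MaxPlus.t_zero])
  rw [h] at hb
  exact hb

theorem add_mem_logGroup {a b : ℝ} (ha : a ∈ logGroup S) (hb : b ∈ logGroup S) :
    a + b ∈ logGroup S := by
  change MaxPlus.t (a + b) ∈ S
  rw [MaxPlus.t_add]
  exact S.mul_mem ha hb

theorem zero_mem_logGroup : (0 : ℝ) ∈ logGroup S := by
  change MaxPlus.t (0 : ℝ) ∈ S
  rw [MaxPlus.t_zero]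
  exact S.one_mem

theorem exponentVector_sub (a b : ℝ) (u v : Fin n → ℤ) :
    exponentVector (a - b) (u - v) = exponentVector a u - exponentVector b v := by
  rw [eq_sub_iff_add_eq, ← exponentVector_add, sub_add_cancel, sub_add_cancel]

theorem exponentVector_neg (a : ℝ) (u : Fin n → ℤ) :
    exponentVector (-a) (-u) = -exponentVector a u := by
  have h := exponentVector_sub 0 a 0 u
  rwa [zero_sub, zero_sub, exponentVector_zero, zero_sub] at h

variable (S) in
/-- Two matrices have the same lexicographically positive exponent vectors in `Γ × M`. -/
def SameLexPositive (C : Matrix (Fin k) (Fin (n + 1)) ℝ) (C' : Matrix (Fin k') (Fin (n + 1)) ℝ) :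
    Prop :=
  ∀ a ∈ logGroup S, ∀ u : Fin n → ℤ,
    LexPositive (C.mulVec (exponentVector a u)) ↔ LexPositive (C'.mulVec (exponentVector a u))

theorem matrixHom_term_le_iff (C : Matrix (Fin k) (Fin (n + 1)) ℝ) (hC : FirstColumnLexNonneg C)
    {a b : ℝ} (ha : MaxPlus.t a ∈ S) (hb : MaxPlus.t b ∈ S) (u v : Fin n → ℤ) :
    matrixHom S C hC (AddMonoidAlgebra.single u ⟨MaxPlus.t a, ha⟩) ≤
        matrixHom S C hC (AddMonoidAlgebra.single v ⟨MaxPlus.t b, hb⟩) ↔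
      ¬ LexPositive (C.mulVec (exponentVector (b - a) (v - u))) := by
  rw [matrixHom_term, matrixHom_term, MaxPlus.t_le_t_iff, ← not_lt, exponentVector_sub,
    Matrix.mulVec_sub]
  exact not_congr (toLex_lt_toLex_iff_lexPositive _ _)

theorem matrixHom_eq_sum (C : Matrix (Fin k) (Fin (n + 1)) ℝ) (hC : FirstColumnLexNonneg C)
    (f : LaurentSemiring S n) :
    matrixHom S C hC f =
      ∑ u ∈ f.coeff.support, matrixHom S C hC (AddMonoidAlgebra.single u (f.coeff u)) := by
  rw [← map_sum]
  exact congrArg _ (AddMonoidAlgebra.sum_coeff_single f).symm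

theorem exists_eq_t_of_mem_support {f : LaurentSemiring S n} {u : Fin n → ℤ}
    (hu : u ∈ f.coeff.support) :
    ∃ (a : ℝ) (ha : MaxPlus.t a ∈ S), f.coeff u = ⟨MaxPlus.t a, ha⟩ := by
  have h0 : (f.coeff u : TropicalReals) ≠ 0 := fun h =>
    Finsupp.mem_support_iff.1 hu (Subtype.ext h)
  obtain ⟨a, ha⟩ := (MaxPlus.eq_zero_or_t _).resolve_left h0
  exact ⟨a, ha ▸ (f.coeff u).2, Subtype.ext ha⟩

/-- The order being reversed, this says that `g` dominates `f` exactly when every term of `f` is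
dominated by a term of `g`. -/
theorem matrixHom_le_iff (C : Matrix (Fin k) (Fin (n + 1)) ℝ) (hC : FirstColumnLexNonneg C)
    (f g : LaurentSemiring S n) :
    matrixHom S C hC g ≤ matrixHom S C hC f ↔
      ∀ u ∈ f.coeff.support, ∃ v ∈ g.coeff.support,
        matrixHom S C hC (AddMonoidAlgebra.single v (g.coeff v)) ≤
          matrixHom S C hC (AddMonoidAlgebra.single u (f.coeff u)) := by
  rw [matrixHom_eq_sum C hC f, MaxPlus.le_sum_iff]
  refine forall₂_congr fun u hu => ?_
  rw [matrixHom_eq_sum C hC g, MaxPlus.sum_le_iff]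
  obtain ⟨a, ha, h⟩ := exists_eq_t_of_mem_support hu
  rw [h, matrixHom_term]
  exact MaxPlus.t_ne_zero _

theorem SameLexPositive.matrixHom_le_iff (hS : IsTropicalSubsemifield S)
    {C : Matrix (Fin k) (Fin (n + 1)) ℝ} {C' : Matrix (Fin k') (Fin (n + 1)) ℝ}
    (h : SameLexPositive S C C') (hC : FirstColumnLexNonneg C) (hC' : FirstColumnLexNonneg C')
    (f g : LaurentSemiring S n) :
    matrixHom S C hC g ≤ matrixHom S C hC f ↔ matrixHom S C' hC' g ≤ matrixHom S C' hC' f := by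
  rw [_root_.matrixHom_le_iff, _root_.matrixHom_le_iff]
  refine forall₂_congr fun u hu => exists_congr fun v => and_congr_right fun hv => ?_
  obtain ⟨a, ha, hfa⟩ := exists_eq_t_of_mem_support hu
  obtain ⟨b, hb, hgb⟩ := exists_eq_t_of_mem_support hv
  rw [hfa, hgb, matrixHom_term_le_iff, matrixHom_term_le_iff, h]
  rw [sub_eq_add_neg]
  exact add_mem_logGroup ha (hS.neg_mem_logGroup hb)

theorem matrixCongruence_eq_iff (hS : IsTropicalSubsemifield S)
    (C : Matrix (Fin k) (Fin (n + 1)) ℝ) (C' : Matrix (Fin k') (Fin (n + 1)) ℝ)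
    (hC : FirstColumnLexNonneg C) (hC' : FirstColumnLexNonneg C') :
    matrixCongruence S C hC = matrixCongruence S C' hC' ↔ SameLexPositive S C C' := by
  constructor
  · intro h a ha u
    -- The binomial `1 + t ^ a χ ^ u` is congruent to `1` exactly when its second term does not
    -- exceed `1`.
    have key : ∀ {m : ℕ} (B : Matrix (Fin m) (Fin (n + 1)) ℝ) (hB : FirstColumnLexNonneg B),
        matrixCongruence S B hB
          (AddMonoidAlgebra.single 0 ⟨MaxPlus.t 0, zero_mem_logGroup⟩ +
            AddMonoidAlgebra.single u ⟨MaxPlus.t a, ha⟩)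
          (AddMonoidAlgebra.single 0 ⟨MaxPlus.t 0, zero_mem_logGroup⟩) ↔
        ¬ LexPositive (B.mulVec (exponentVector a u)) := fun B hB => by
      rw [matrixCongruence, RingCon.ker_apply, map_add, Tropical.add_eq_left_iff]
      refine (matrixHom_term_le_iff B hB zero_mem_logGroup ha 0 u).trans ?_
      rw [sub_zero, sub_zero]
    rw [← not_iff_not, ← key C hC, ← key C' hC', h]
  · intro h
    refine RingCon.ext fun f g => ?_
    rw [matrixCongruence, matrixCongruence, RingCon.ker_apply, RingCon.ker_apply,
      le_antisymm_iff, le_antisymm_iff, h.matrixHom_le_iff hS hC hC',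
      h.matrixHom_le_iff hS hC hC']

end

/-! ## Relative interiors of the cones of a matrix flag -/

section

variable {n k : ℕ}

theorem row_mem_rowCone (D : Matrix (Fin k) (Fin (n + 1)) ℝ) {i j : Fin k} (hij : j ≤ i) :
    D j ∈ rowCone D i :=
  PointedCone.subset_hull ⟨j, hij, rfl⟩

/-- A segment that ends in the relative interior of a set can be prolonged inside the set. -/
theorem exists_prolongation_mem_of_mem_intrinsicInterior {E : Type*} [NormedAddCommGroup E]
    [NormedSpace ℝ E] {s : Set E} {x y : E} (hx : x ∈ intrinsicInterior ℝ s) (hy : y ∈ s) :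
    ∃ ε : ℝ, 0 < ε ∧ x + ε • (x - y) ∈ s := by
  obtain ⟨z, hz, rfl⟩ := mem_intrinsicInterior.1 hx
  -- At parameter `-ε` the line from `z` to `y` is at a point beyond `z`, still in the affine span;
  -- for small `ε` it is in `s` because `z` is interior relative to that span.
  have hmem : ∀ ε : ℝ, AffineMap.lineMap (z : E) y (-ε) ∈ affineSpan ℝ s := fun ε =>
    AffineMap.lineMap_mem _ z.2 (subset_affineSpan ℝ s hy)
  have hcont : Continuous fun ε : ℝ => (⟨_, hmem ε⟩ : affineSpan ℝ s) := by
    refine Continuous.subtype_mk ?_ _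
    simp only [AffineMap.lineMap_apply]
    fun_prop
  have h0 : (⟨_, hmem 0⟩ : affineSpan ℝ s) = z := Subtype.ext (by simp)
  have hev := hcont.continuousAt.eventually_mem (x := 0)
    (by rw [h0]; exact mem_interior_iff_mem_nhds.1 hz)
  obtain ⟨ε, hε, hpos⟩ := ((hev.filter_mono nhdsWithin_le_nhds).and
    (self_mem_nhdsWithin : ∀ᶠ ε in nhdsWithin (0 : ℝ) (Set.Ioi 0), ε ∈ Set.Ioi 0)).exists
  refine ⟨ε, hpos, ?_⟩
  have hε' : AffineMap.lineMap (z : E) y (-ε) ∈ s := hε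
  rw [AffineMap.lineMap_apply] at hε'
  convert hε' using 1
  simp only [vsub_eq_sub, vadd_eq_add, smul_sub, neg_smul]
  abel

/-- Independence of the rows makes the coefficients continuous coordinates. Positivity of those with
index at most `i` is an open condition, and within the affine span, where the later ones vanish, it
implies membership in the cone. -/
theorem sum_smul_mem_intrinsicInterior_rowCone {D : Matrix (Fin k) (Fin (n + 1)) ℝ}
    (hD : LinearIndependent ℝ fun i => D i) (i : Fin k) {c : Fin k → ℝ}
    (hpos : ∀ j ≤ i, 0 < c j) (hzero : ∀ j, i < j → c j = 0) :
    ∑ j, c j • D j ∈ intrinsicInterior ℝ (rowCone D i : Set (Fin (n + 1) → ℝ)) := by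
  -- The left inverse `g` reads off the coefficients of a combination of rows.
  obtain ⟨g, hg⟩ := (Fintype.linearCombination ℝ fun j => D j).exists_leftInverse_of_injective
    (LinearMap.ker_eq_bot.2 hD.fintypeLinearCombination_injective)
  have hg' : ∀ b : Fin k → ℝ, g (∑ j, b j • D j) = b := fun b => by
    simpa [Fintype.linearCombination_apply] using LinearMap.congr_fun hg b
  have hgc : Continuous g := g.continuous_of_finiteDimensional
  have hspan : ∀ y ∈ affineSpan ℝ (rowCone D i : Set (Fin (n + 1) → ℝ)),
      ∃ b : Fin k → ℝ, (∀ j, i < j → b j = 0) ∧ ∑ j, b j • D j = y := by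
    intro y hy
    refine affineSpan_induction hy ?_ ?_
    · intro x hx
      obtain ⟨b, -, hb, hsum⟩ := (mem_rowCone D i x).1 hx
      exact ⟨b, hb, hsum⟩
    · rintro r _ _ _ ⟨b₁, h₁, rfl⟩ ⟨b₂, h₂, rfl⟩ ⟨b₃, h₃, rfl⟩
      refine ⟨r • (b₁ - b₂) + b₃, fun j hj => by simp [h₁ j hj, h₂ j hj, h₃ j hj], ?_⟩
      simp only [Pi.add_apply, Pi.smul_apply, Pi.sub_apply, smul_eq_mul, add_smul, mul_smul,
        sub_smul, Finset.sum_add_distrib, Finset.sum_sub_distrib, ← Finset.smul_sum,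
        vsub_eq_sub, vadd_eq_add]
  have hmem : ∑ j, c j • D j ∈ rowCone D i :=
    (mem_rowCone D i _).2 ⟨c, fun j => (le_or_gt j i).elim (fun h => (hpos j h).le)
      (fun h => (hzero j h).ge), hzero, rfl⟩
  refine mem_intrinsicInterior.2 ⟨⟨_, subset_affineSpan ℝ _ hmem⟩, ?_, rfl⟩
  refine mem_interior.2 ⟨{y | ∀ j ≤ i, 0 < g y j}, ?_, ?_, ?_⟩
  · rintro ⟨y, hy⟩ hyp
    obtain ⟨b, hb, rfl⟩ := hspan y hy
    have hyp : ∀ j ≤ i, 0 < b j := fun j hj => by simpa [hg'] using hyp j hj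
    exact (mem_rowCone D i _).2 ⟨b, fun j => (le_or_gt j i).elim (fun h => (hyp j h).le)
      (fun h => (hb j h).ge), hb, rfl⟩
  · simp only [Set.ofPred_forall]
    refine isOpen_iInter_of_finite fun j => isOpen_iInter_of_finite fun _ => ?_
    exact isOpen_lt continuous_const ((continuous_apply j).comp (hgc.comp continuous_subtype_val))
  · intro j hj
    simpa [hg'] using hpos j hj

/-- If the first nonzero pairing is positive, at row `i`, then `p` is nonnegative on the `i`-th
cone. Moving `w` slightly away from `D i` stays in the cone but makes the pairing negative. -/
theorem not_lexPositive_of_forall_exists_dotProduct_nonpos {D : Matrix (Fin k) (Fin (n + 1)) ℝ}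
    {p : Fin (n + 1) → ℝ}
    (h : ∀ i, ∃ w ∈ intrinsicInterior ℝ (rowCone D i : Set (Fin (n + 1) → ℝ)), w ⬝ᵥ p ≤ 0) :
    ¬ LexPositive (D.mulVec p) := by
  rintro ⟨i, hi, hpos⟩
  obtain ⟨w, hw, hwp⟩ := h i
  have hnonneg : ∀ x ∈ rowCone D i, 0 ≤ x ⬝ᵥ p := by
    intro x hx
    obtain ⟨c, hc, hc', rfl⟩ := (mem_rowCone D i x).1 hx
    rw [sum_dotProduct]
    refine Finset.sum_nonneg fun j _ => ?_
    rw [smul_dotProduct, smul_eq_mul]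
    rcases lt_trichotomy j i with h | rfl | h
    · rw [show D j ⬝ᵥ p = 0 from hi j h, mul_zero]
    · exact mul_nonneg (hc _) hpos.le
    · rw [hc' j h, zero_mul]
  obtain ⟨ε, hε, hmem⟩ :=
    exists_prolongation_mem_of_mem_intrinsicInterior hw (row_mem_rowCone D le_rfl : D i ∈ _)
  have h1 := hnonneg _ hmem
  rw [add_dotProduct, smul_dotProduct, sub_dotProduct, smul_eq_mul] at h1
  have h2 : 0 < D i ⬝ᵥ p := hpos
  nlinarith [mul_pos hε h2, mul_nonneg hε.le (neg_nonneg.2 hwp)]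

open Filter Topology in
-- The witness is `∑ εʲ Dⱼ` over `j ≤ i`; since `E` is finite, one small `ε` serves all its
-- elements.
theorem exists_mem_intrinsicInterior_dotProduct_nonpos {D : Matrix (Fin k) (Fin (n + 1)) ℝ}
    (hD : IsReducedMatrix D) (E : Finset (Fin (n + 1) → ℝ))
    (hE : ∀ p ∈ E, ¬ LexPositive (D.mulVec p)) (i : Fin k) :
    ∃ w ∈ intrinsicInterior ℝ (rowCone D i : Set (Fin (n + 1) → ℝ)),
      0 ≤ w 0 ∧ ∀ p ∈ E, w ⬝ᵥ p ≤ 0 := by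
  have hev : ∀ p ∈ E, ∀ᶠ ε in 𝓝[>] (0 : ℝ),
      ∑ j : Fin k, ε ^ (j : ℕ) * (if j ≤ i then D.mulVec p j else 0) ≤ 0 := by
    intro p hp
    -- Dropping the entries after `i` creates no lexicographic positivity: a positive leading entry
    -- that survives was already leading.
    refine eventually_sum_pow_mul_nonpos fun ⟨m, hm, hpos⟩ => hE p hp ?_
    have hmi : m ≤ i := by
      by_contra h
      simp [h] at hpos
    refine ⟨m, fun j hj => ?_, by simpa [hmi] using hpos⟩
    simpa [hj.le.trans hmi] using hm j hj
  obtain ⟨ε, hε, hpos⟩ := (((Finset.eventually_all E).2 hev).and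
    (self_mem_nhdsWithin : ∀ᶠ ε in 𝓝[>] (0 : ℝ), ε ∈ Set.Ioi 0)).exists
  have hpos : 0 < ε := hpos
  have hw := sum_smul_mem_intrinsicInterior_rowCone hD.linearIndependent i
    (c := fun j => if j ≤ i then ε ^ (j : ℕ) else 0)
    (fun j hj => by simpa [hj] using pow_pos hpos _) (fun j hj => by simp [hj])
  refine ⟨_, hw, (matrixFlag D hD).mem_halfSpace i _ (intrinsicInterior_subset hw),
    fun p hp => ?_⟩
  refine le_of_eq_of_le ?_ (hε p hp)
  rw [sum_dotProduct]
  refine Finset.sum_congr rfl fun j _ => ?_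
  rw [smul_dotProduct, smul_eq_mul]
  split_ifs
  · rfl
  · rw [zero_mul, mul_zero]

/-- The cone cut out of the half-space `ℝ≥0 × N_ℝ` by finitely many exponent vectors. -/
def cutCone (E : Finset (ℝ × (Fin n → ℤ))) : PointedCone ℝ (Fin (n + 1) → ℝ) where
  carrier := {w | 0 ≤ w 0 ∧ ∀ p ∈ E, w ⬝ᵥ exponentVector p.1 p.2 ≤ 0}
  zero_mem' := ⟨le_rfl, fun p _ => by rw [zero_dotProduct]⟩
  add_mem' := fun ⟨h, h'⟩ ⟨g, g'⟩ => ⟨add_nonneg h g, fun p hp => by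
    rw [add_dotProduct]; exact add_nonpos (h' p hp) (g' p hp)⟩
  smul_mem' := fun r w ⟨h, h'⟩ => ⟨mul_nonneg r.2 h, fun p hp => by
    rw [smul_dotProduct]; exact mul_nonpos_of_nonneg_of_nonpos r.2 (h' p hp)⟩

theorem mem_cutCone {E : Finset (ℝ × (Fin n → ℤ))} {w : Fin (n + 1) → ℝ} :
    w ∈ cutCone E ↔ 0 ≤ w 0 ∧ ∀ p ∈ E, w ⬝ᵥ exponentVector p.1 p.2 ≤ 0 :=
  Iff.rfl

/-- A cone cut out by `E` meets the relative interiors of all cones of the flag of `D` if and only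
if no element of `E` is lexicographically positive for `D`. -/
theorem forall_inter_intrinsicInterior_nonempty_iff {D : Matrix (Fin k) (Fin (n + 1)) ℝ}
    (hD : IsReducedMatrix D) {σ : PointedCone ℝ (Fin (n + 1) → ℝ)}
    {E : Finset (ℝ × (Fin n → ℤ))}
    (hσ : ∀ w, w ∈ σ ↔ 0 ≤ w 0 ∧ ∀ p ∈ E, w ⬝ᵥ exponentVector p.1 p.2 ≤ 0) :
    (∀ i, ((σ : Set (Fin (n + 1) → ℝ)) ∩
      intrinsicInterior ℝ ((matrixFlag D hD).cone i : Set (Fin (n + 1) → ℝ))).Nonempty) ↔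
    ∀ p ∈ E, ¬ LexPositive (D.mulVec (exponentVector p.1 p.2)) := by
  constructor
  · intro h p hp
    refine not_lexPositive_of_forall_exists_dotProduct_nonpos fun i => ?_
    obtain ⟨w, hwσ, hw⟩ := h i
    exact ⟨w, hw, ((hσ w).1 hwσ).2 p hp⟩
  · intro h i
    classical
    obtain ⟨w, hw, h0, hE⟩ := exists_mem_intrinsicInterior_dotProduct_nonpos hD
      (E.image fun p => exponentVector p.1 p.2) (Finset.forall_mem_image.2 h) i
    refine ⟨w, (hσ w).2 ⟨h0, fun p hp => hE _ (Finset.mem_image_of_mem _ hp)⟩, hw⟩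

theorem dotProduct_exponentVector_zero_single (w : Fin (n + 1) → ℝ) (j : Fin n) (z : ℤ) :
    w ⬝ᵥ exponentVector 0 (Pi.single j z) = w j.succ * z := by
  rw [dotProduct, Fin.sum_univ_succ, Finset.sum_eq_single j]
  · simp [exponentVector]
  · intro l _ hl
    simp [exponentVector, hl]
  · simp

/-- A cone in the half-space that lies in an orthant is strongly convex. -/
theorem salient_of_mem_orthant {σ : PointedCone ℝ (Fin (n + 1) → ℝ)} {z : Fin n → ℤ}
    (hz : ∀ j, z j ≠ 0) (h0 : ∀ w ∈ σ, 0 ≤ w 0) (h : ∀ w ∈ σ, ∀ j : Fin n, w j.succ * z j ≤ 0) :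
    (σ : ConvexCone ℝ (Fin (n + 1) → ℝ)).Salient := by
  intro w hw hne hnw
  refine hne (funext fun i => Fin.cases ?_ (fun j => ?_) i)
  · have h1 := h0 w hw
    have h2 := h0 (-w) hnw
    simp only [Pi.neg_apply, Pi.zero_apply] at h2 ⊢
    linarith
  · have h1 := h w hw j
    have h2 := h (-w) hnw j
    simp only [Pi.neg_apply, Pi.zero_apply] at h2 ⊢
    have h3 : w j.succ * z j = 0 := by linarith
    exact (mul_eq_zero.1 h3).resolve_right (Int.cast_ne_zero.2 (hz j))

end

/-! ## Local equivalence -/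

section

variable {S : Subsemiring TropicalReals} {n k k' : ℕ}

theorem LocallyEquivalent.symm {Γ : Set ℝ} {F : FlagOfCones n k} {F' : FlagOfCones n k'}
    (h : LocallyEquivalent Γ F F') : LocallyEquivalent Γ F' F :=
  fun σ => (h σ).symm

theorem SameLexPositive.locallyEquivalent {D : Matrix (Fin k) (Fin (n + 1)) ℝ}
    {D' : Matrix (Fin k') (Fin (n + 1)) ℝ} (h : SameLexPositive S D D')
    (hD : IsReducedMatrix D) (hD' : IsReducedMatrix D') :
    LocallyEquivalent (logGroup S) (matrixFlag D hD) (matrixFlag D' hD') := by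
  refine fun σ => and_congr_right fun ⟨_, E, hE, hσ⟩ => ?_
  rw [forall_inter_intrinsicInterior_nonempty_iff hD hσ,
    forall_inter_intrinsicInterior_nonempty_iff hD' hσ]
  exact forall₂_congr fun p hp => not_congr (h p.1 (hE p hp) p.2)

/-- The inequality of `(a, u)` alone may not cut out a strongly convex cone. Adding one signed
coordinate inequality per direction, each nonpositive for `D`, confines the cone to an orthant and
keeps it a neighborhood of the flag of `D`, hence of that of `D'`. -/
theorem LocallyEquivalent.not_lexPositive {D : Matrix (Fin k) (Fin (n + 1)) ℝ}
    {D' : Matrix (Fin k') (Fin (n + 1)) ℝ} {hD : IsReducedMatrix D} {hD' : IsReducedMatrix D'}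
    (h : LocallyEquivalent (logGroup S) (matrixFlag D hD) (matrixFlag D' hD'))
    {a : ℝ} (ha : a ∈ logGroup S) {u : Fin n → ℤ}
    (hau : ¬ LexPositive (D.mulVec (exponentVector a u))) :
    ¬ LexPositive (D'.mulVec (exponentVector a u)) := by
  classical
  have hsign : ∀ j : Fin n, ∃ z : ℤ, z ≠ 0 ∧
      ¬ LexPositive (D.mulVec (exponentVector 0 (Pi.single j z))) := by
    intro j
    -- A coordinate vector and its negative are never both lexicographically positive.
    by_cases h1 : LexPositive (D.mulVec (exponentVector 0 (Pi.single j 1)))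
    · refine ⟨-1, by norm_num, ?_⟩
      have h2 := exponentVector_neg 0 (Pi.single j (1 : ℤ))
      rw [neg_zero, ← Pi.single_neg] at h2
      rw [h2, Matrix.mulVec_neg]
      exact h1.not_neg
    · exact ⟨1, one_ne_zero, h1⟩
  choose z hz hzD using hsign
  let E : Finset (ℝ × (Fin n → ℤ)) :=
    insert (a, u) (Finset.univ.image fun j => (0, Pi.single j (z j)))
  have hE : ∀ p ∈ E, p.1 ∈ logGroup S := by
    simp only [E, Finset.forall_mem_insert, Finset.forall_mem_image]
    exact ⟨ha, fun _ _ => zero_mem_logGroup⟩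
  have hED : ∀ p ∈ E, ¬ LexPositive (D.mulVec (exponentVector p.1 p.2)) := by
    simp only [E, Finset.forall_mem_insert, Finset.forall_mem_image]
    exact ⟨hau, fun j _ => hzD j⟩
  have hadm : IsAdmissibleCone (logGroup S) (cutCone E) := by
    refine ⟨salient_of_mem_orthant hz (fun w hw => hw.1) fun w hw j => ?_, E, hE,
      fun w => mem_cutCone⟩
    rw [← dotProduct_exponentVector_zero_single]
    exact hw.2 _ (Finset.mem_insert_of_mem (Finset.mem_image_of_mem _ (Finset.mem_univ j)))
  have hnbhd := (h (cutCone E)).1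
    ⟨hadm, (forall_inter_intrinsicInterior_nonempty_iff hD fun w => mem_cutCone).2 hED⟩
  exact (forall_inter_intrinsicInterior_nonempty_iff hD' fun w => mem_cutCone).1 hnbhd.2 (a, u)
    (Finset.mem_insert_self _ _)

theorem locallyEquivalent_matrixFlag_iff {D : Matrix (Fin k) (Fin (n + 1)) ℝ}
    {D' : Matrix (Fin k') (Fin (n + 1)) ℝ} (hD : IsReducedMatrix D) (hD' : IsReducedMatrix D') :
    LocallyEquivalent (logGroup S) (matrixFlag D hD) (matrixFlag D' hD') ↔
      SameLexPositive S D D' :=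
  ⟨fun h _ ha _ => not_iff_not.1 ⟨h.not_lexPositive ha, h.symm.not_lexPositive ha⟩,
    fun h => h.locallyEquivalent hD hD'⟩

end

theorem mainTheorem8 (S : Subsemiring TropicalReals) (hS : IsTropicalSubsemifield S)
    (n k k' : ℕ) (C : Matrix (Fin k) (Fin (n + 1)) ℝ) (C' : Matrix (Fin k') (Fin (n + 1)) ℝ)
    (hC : FirstColumnLexNonneg C) (hC' : FirstColumnLexNonneg C') :
    (∃ (l : ℕ) (D : Matrix (Fin l) (Fin (n + 1)) ℝ),
      DownwardReduction C D ∧ IsReducedMatrix D) ∧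
    (∃ (l : ℕ) (D : Matrix (Fin l) (Fin (n + 1)) ℝ),
      DownwardReduction C' D ∧ IsReducedMatrix D) ∧
    ∀ (l l' : ℕ) (D : Matrix (Fin l) (Fin (n + 1)) ℝ) (D' : Matrix (Fin l') (Fin (n + 1)) ℝ)
      (_ : DownwardReduction C D) (_ : DownwardReduction C' D')
      (hD : IsReducedMatrix D) (hD' : IsReducedMatrix D'),
      matrixCongruence S C hC = matrixCongruence S C' hC' ↔
        LocallyEquivalent (logGroup S) (matrixFlag D hD) (matrixFlag D' hD') := by
  refine ⟨exists_downwardReduction_isReducedMatrix C hC,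
    exists_downwardReduction_isReducedMatrix C' hC', fun l l' D D' h h' hD hD' => ?_⟩
  rw [matrixCongruence_eq_iff hS, locallyEquivalent_matrixFlag_iff]
  -- It remains to compare the condition for `C`, `C'` with that for `D`, `D'`, vector by vector.
  refine forall₃_congr fun a _ u => ?_
  rw [h.lexPositive_mulVec_iff, h'.lexPositive_mulVec_iff]
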